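/- For hypergraphs $F$ and $T$ with $V(F)\subseteq V(T)$, say that $T$ is a trace of $F$ if there is a bijection $\phi:E(F)\to E(T)$ with $\phi(e)\cap V(F)=e$ for every $e\in E(F)$. A hypergraph $H$ contains $F$ as a trace if some subhypergraph of $H$ is isomorphic to a trace of $F$. Let $\mathrm{ex}(n,\mathrm{Tr}_3(C_4))$ be the maximum number of edges in an $n$-vertex $3$-uniform hypergraph that does not contain the $4$-cycle $C_4$ as a trace. Then, as $n\to\infty$, $$\tfrac12 n^{3/2}+o(n^{3/2})\ \le\ \mathrm{ex}(n,\mathrm{Tr}_3(C_4))\ \le\ \tfrac56 n^{3/2}+o(n^{3/2}).$$ -/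

import Mathlib

open Filter Asymptotics
open scoped Hypergraph

namespace TraceTuran

/-- A hypergraph is `r`-uniform if all its edges have exactly `r` vertices. -/
def IsUniform {α : Type*} (H : Hypergraph α) (r : ℕ) : Prop :=
  ∀ e ∈ E(H), e.encard = r

/-- `T` is a subhypergraph of `H`. -/
def IsSub {α : Type*} (T H : Hypergraph α) : Prop :=
  V(T) ⊆ V(H) ∧ E(T) ⊆ E(H)

/-- `T` is a trace of `F` on `V(F)`: `V(F) ⊆ V(T)` and there is a bijection `φ : E(F) → E(T)` with
`φ(e) ∩ V(F) = e` for every edge `e` of `F`. -/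
def IsTraceOf {α : Type*} (T F : Hypergraph α) : Prop :=
  V(F) ⊆ V(T) ∧ ∃ φ : E(F) ≃ E(T), ∀ e : E(F), (φ e : Set α) ∩ V(F) = (e : Set α)

/-- `H` contains `F` as a trace: some subhypergraph `T` of `H` is isomorphic to a trace of `F`, i.e.
`T` is a trace of an isomorphic copy of `F` (the image of `F` under a map `f` that is injective on
`V(F)`) living on vertices of `H`. -/
def ContainsTrace {α β : Type*} (H : Hypergraph β) (F : Hypergraph α) : Prop :=
  ∃ f : α → β, Set.InjOn f V(F) ∧ ∃ T : Hypergraph β, IsSub T H ∧ IsTraceOf T (F.image f)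

/-- `ex(n, Tr_r(F))`: the maximum number of edges of an `r`-uniform hypergraph with vertex set
`Fin n` that does not contain `F` as a trace. -/
noncomputable def exTrace {α : Type*} (n r : ℕ) (F : Hypergraph α) : ℕ :=
  sSup {m : ℕ | ∃ H : Hypergraph (Fin n), V(H) = Set.univ ∧ IsUniform H r ∧
    ¬ ContainsTrace H F ∧ E(H).ncard = m}

/-- A simple graph, seen as a (`2`-uniform) hypergraph. -/
def ofSimpleGraph {V : Type*} (G : SimpleGraph V) : Hypergraph V where
  vertexSet := Set.univ
  edgeSet := {e | ∃ u v, G.Adj u v ∧ e = {u, v}}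
  subset_vertexSet_of_mem_edgeSet' := fun _ _ => Set.subset_univ _

/-- The four-cycle `C₄`. -/
def cycleFour : Hypergraph (Fin 4) := ofSimpleGraph (SimpleGraph.cycleGraph 4)

end TraceTuran

/-! Lower bound. The polarity graph `y + y' = x * x'` on the plane over the field with `q` elements
has no four-cycle, because the relation lets two distinct points have at most one common neighbour.
Joining one apex to all its edges gives triples. The apex lies in every triple, so it cannot be a
vertex of a traced cycle, and such a cycle would already live in the graph. This gives about `q ^ 3
/ 2` triples on `q ^ 2 + 1` vertices. To reach every `n`, prime powers must be asymptotically dense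
on the logarithmic scale (`exists_isPrimePow_between`). This follows by a Wiener–Ikehara argument:
the logarithmic derivative of zeta minus its pole is continuous up to `Re s = 1`, and testing it
against a Fejér kernel and applying the Riemann–Lebesgue lemma rules out long gaps.

Upper bound. Split the triples into the core, whose pairs all lie in a second triple, and the rest.
Each triple of the rest owns a private pair; one chosen private pair per triple gives a graph
without four-cycles, hence at most `n ^ (3/2) / 2` triples up to `O(n)` (`sq_card_compl_core_le`).
In the core, third vertices can be exchanged to avoid a given vertex. Hence a pair lies in at most
two core triples (`core_pair_le_two`), and the shadow of the core has codegrees at most one apart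
from an error of small total (`coreAdj_codegree_le`). So the shadow has about `n ^ (3/2) / 2` edges
at most and the core about `n ^ (3/2) / 3` triples; `1/2 + 1/3 = 5/6`. -/

namespace TraceTuran

/-! ### Fejér kernel and the smoothed von Mangoldt sum -/

open MeasureTheory Set

/-- The Fejér kernel, i.e. the Fourier transform of the triangle function on `[-T, T]`. -/
noncomputable def fejer (T u : ℝ) : ℝ := 2 * ∫ t in (0 : ℝ)..T, (1 - t / T) * Real.cos (t * u)

theorem fejer_zero {T : ℝ} (hT : 0 < T) : fejer T 0 = T := by
  have h : ∫ t in (0 : ℝ)..T, (1 - t / T) = T / 2 := by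
    rw [intervalIntegral.integral_sub (by simp) (by apply Continuous.intervalIntegrable; fun_prop),
      intervalIntegral.integral_div, integral_id]
    simp
    field_simp
    ring
  simp [fejer, h]
  ring

theorem fejer_eq {T u : ℝ} (hT : 0 < T) (hu : u ≠ 0) :
    fejer T u = 2 * (1 - Real.cos (T * u)) / (T * u ^ 2) := by
  have hd : ∀ t ∈ uIcc 0 T, HasDerivAt
      (fun t : ℝ => (1 - t / T) * (Real.sin (t * u) / u) - Real.cos (t * u) / (T * u ^ 2))
      ((1 - t / T) * Real.cos (t * u)) t := by
    intro t _
    have h1 : HasDerivAt (fun t : ℝ => t * u) u t := by simpa using (hasDerivAt_id t).mul_const u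
    have h2 : HasDerivAt (fun t : ℝ => 1 - t / T) (-(1 / T)) t := by
      simpa using ((hasDerivAt_id t).div_const T).const_sub 1
    convert! (h2.mul (h1.sin.div_const u)).sub (h1.cos.div_const (T * u ^ 2)) using 1
    field_simp
    ring
  have := intervalIntegral.integral_eq_sub_of_hasDerivAt hd
    (by apply Continuous.intervalIntegrable; fun_prop)
  rw [fejer, this]
  field_simp
  simp
  ring

theorem fejer_nonneg {T : ℝ} (hT : 0 < T) (u : ℝ) : 0 ≤ fejer T u := by
  rcases eq_or_ne u 0 with rfl | hu
  · rw [fejer_zero hT]; exact hT.le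
  · rw [fejer_eq hT hu]
    have := Real.cos_le_one (T * u)
    have : 0 ≤ 1 - Real.cos (T * u) := by linarith
    positivity

theorem fejer_le {T u : ℝ} (hT : 0 < T) (hu : u ≠ 0) : fejer T u ≤ 4 / (T * u ^ 2) := by
  rw [fejer_eq hT hu]
  have := Real.neg_one_le_cos (T * u)
  gcongr
  linarith

theorem le_fejer {T u : ℝ} (hT : 0 < T) (hu : |u| ≤ 1 / T) : T / 2 ≤ fejer T u := by
  rcases eq_or_ne u 0 with rfl | hu0
  · rw [fejer_zero hT]; linarith
  · have h1 : |T * u| ≤ 1 := by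
      rw [abs_mul, abs_of_pos hT]
      calc T * |u| ≤ T * (1 / T) := by gcongr
        _ = 1 := by field_simp
    have h2 := (abs_le.1 (Real.cos_bound h1)).2
    have h3 : |T * u| ^ 4 ≤ (T * u) ^ 2 := by
      have : |T * u| ^ 4 = (T * u) ^ 2 * |T * u| ^ 2 := by rw [← sq_abs (T * u)]; ring
      rw [this]
      have h4 : |T * u| ^ 2 ≤ 1 := pow_le_one₀ (abs_nonneg _) h1
      nlinarith [sq_nonneg (T * u)]
    rw [fejer_eq hT hu0, le_div_iff₀ (by positivity)]
    nlinarith [sq_nonneg (T * u)]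

theorem continuous_fejer (T : ℝ) : Continuous (fejer T) := by
  unfold fejer
  apply Continuous.mul continuous_const
  exact intervalIntegral.continuous_parametric_intervalIntegral_of_continuous
    (by fun_prop) continuous_const

open ArithmeticFunction in
theorem re_exp_mul_term_vonMangoldt (δ y t : ℝ) (n : ℕ) :
    (Complex.exp (t * y * Complex.I) *
      LSeries.term (fun n => (Λ n : ℂ)) (1 + δ + t * Complex.I) n).re =
    Λ n / (n : ℝ) ^ (1 + δ) * Real.cos (t * (y - Real.log n)) := by
  rcases eq_or_ne n 0 with rfl | hn
  · simp
  · have hn' : (0 : ℝ) < n := by positivity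
    rw [LSeries.term_of_ne_zero hn]
    have h1 : ((n : ℕ) : ℂ) ^ (1 + δ + t * Complex.I : ℂ) =
        (((n : ℝ) ^ (1 + δ) : ℝ) : ℂ) * Complex.exp ((t * Real.log n : ℝ) * Complex.I) := by
      rw [Complex.cpow_add _ _ (by exact_mod_cast hn), Complex.ofReal_cpow hn'.le,
        Complex.cpow_def_of_ne_zero (by exact_mod_cast hn) (t * Complex.I)]
      push_cast
      congr 2
      rw [← Complex.natCast_log]
      ring
    have h2 : Complex.exp (t * y * Complex.I) *
        ((Λ n : ℂ) / ((((n : ℝ) ^ (1 + δ) : ℝ) : ℂ) *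
          Complex.exp ((t * Real.log n : ℝ) * Complex.I))) =
        ((Λ n / (n : ℝ) ^ (1 + δ) : ℝ) : ℂ) *
          Complex.exp ((t * (y - Real.log n) : ℝ) * Complex.I) := by
      have : ((t * (y - Real.log n) : ℝ) * Complex.I) =
        (t * y * Complex.I) - ((t * Real.log n : ℝ) * Complex.I) := by push_cast; ring
      rw [this, Complex.exp_sub]
      push_cast
      field_simp
    rw [h1, h2, Complex.re_ofReal_mul, Complex.exp_ofReal_mul_I_re]

open ArithmeticFunction in
theorem summable_vonMangoldt_div_rpow {δ : ℝ} (hδ : 0 < δ) :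
    Summable fun n : ℕ => Λ n / (n : ℝ) ^ (1 + δ) := by
  have h := LSeriesSummable_vonMangoldt (s := 1 + δ) (by simpa using hδ)
  have := (Complex.reCLM.summable h)
  refine this.congr fun n => ?_
  simpa using re_exp_mul_term_vonMangoldt δ 0 0 n

-- Smoothing in `log n` becomes an integral of the L-series over a compact vertical segment.
-- Absolute convergence for `δ > 0` allows the exchange of sum and integral.
open ArithmeticFunction in
theorem tsum_vonMangoldt_mul_fejer {δ T : ℝ} (hδ : 0 < δ) (hT : 0 < T) (y : ℝ) :
    ∑' n : ℕ, Λ n / (n : ℝ) ^ (1 + δ) * fejer T (y - Real.log n) =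
      2 * ∫ t in (0 : ℝ)..T, (1 - t / T) * (Complex.exp (t * y * Complex.I) *
        LSeries (fun n => (Λ n : ℂ)) (1 + δ + t * Complex.I)).re := by
  have hs : ∀ t : ℝ, (Complex.exp (t * y * Complex.I) *
        LSeries (fun n => (Λ n : ℂ)) (1 + δ + t * Complex.I)).re =
      ∑' n : ℕ, Λ n / (n : ℝ) ^ (1 + δ) * Real.cos (t * (y - Real.log n)) := by
    intro t
    have h := LSeriesSummable_vonMangoldt (s := 1 + δ + t * Complex.I) (by simpa using hδ)
    rw [LSeries, ← tsum_mul_left, Complex.re_tsum (h.mul_left _)]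
    exact tsum_congr fun n => re_exp_mul_term_vonMangoldt δ y t n
  let f : ℕ → C(ℝ, ℝ) := fun n =>
    ⟨fun t => (1 - t / T) * (Λ n / (n : ℝ) ^ (1 + δ) * Real.cos (t * (y - Real.log n))),
      by fun_prop⟩
  have hf := intervalIntegral.tsum_intervalIntegral_eq_of_summable_norm (a := 0) (b := T) (f := f)
    (by
      refine Summable.of_nonneg_of_le (fun _ => norm_nonneg _) (fun n => ?_)
        (summable_vonMangoldt_div_rpow hδ)
      have hΛ : 0 ≤ Λ n / (n : ℝ) ^ (1 + δ) := div_nonneg vonMangoldt_nonneg (by positivity)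
      rw [ContinuousMap.norm_le _ hΛ]
      rintro ⟨t, ht⟩
      rw [TopologicalSpace.Compacts.coe_mk, uIcc_of_le hT.le] at ht
      simp only [f, ContinuousMap.restrict_apply, ContinuousMap.coe_mk, Real.norm_eq_abs, abs_mul]
      have h1 : |1 - t / T| ≤ 1 := by
        have : t / T ≤ 1 := by rw [div_le_one hT]; exact ht.2
        have : 0 ≤ t / T := div_nonneg ht.1 hT.le
        rw [abs_le]; constructor <;> linarith
      rw [abs_of_nonneg hΛ]
      calc _ ≤ 1 * (Λ n / (n : ℝ) ^ (1 + δ) * 1) := by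
            gcongr
            exact Real.abs_cos_le_one _
        _ = _ := by ring)
  simp_rw [hs, ← tsum_mul_left]
  rw [show (∫ t in (0 : ℝ)..T, ∑' n : ℕ,
    (1 - t / T) * (Λ n / (n : ℝ) ^ (1 + δ) * Real.cos (t * (y - Real.log n)))) =
    ∫ t in (0 : ℝ)..T, ∑' n, f n t from rfl, ← hf, ← tsum_mul_left]
  refine tsum_congr fun n => ?_
  rw [fejer, mul_left_comm, ← intervalIntegral.integral_const_mul]
  congr 2
  ext t
  simp only [f, ContinuousMap.coe_mk]
  ring

end TraceTuran

/-! ### Pole contribution, boundary limit and Riemann–Lebesgue -/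

namespace TraceTuran

open MeasureTheory Set Filter

theorem re_exp_div_eq_integral {δ : ℝ} (hδ : 0 < δ) (y t : ℝ) :
    (Complex.exp (t * y * Complex.I) * (1 / (δ + t * Complex.I))).re =
      ∫ v in Ioi (0 : ℝ), Real.exp (-δ * v) * Real.cos (t * (y - v)) := by
  have hre : (-(δ + t * Complex.I) : ℂ).re < 0 := by simpa using hδ
  have h1 := integral_exp_mul_complex_Ioi hre 0
  have h2 := integrableOn_exp_mul_complex_Ioi hre 0
  have h3 : (1 / (δ + t * Complex.I) : ℂ) =
      ∫ v in Ioi (0 : ℝ), Complex.exp (-(δ + t * Complex.I) * v) := by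
    rw [h1, neg_div_neg_eq]
    simp
  rw [h3, ← integral_const_mul]
  have h4 := Complex.reCLM.integral_comp_comm
    (h2.integrable.const_mul (Complex.exp (t * y * Complex.I)))
  simp only [Complex.reCLM_apply] at h4
  rw [← h4]
  congr 1
  ext v
  rw [← Complex.exp_add]
  have : t * y * Complex.I + -(δ + t * Complex.I) * v =
    ((-δ * v : ℝ) : ℂ) + ((t * (y - v) : ℝ) : ℂ) * Complex.I := by push_cast; ring
  rw [this, Complex.exp_add, ← Complex.ofReal_exp, Complex.re_ofReal_mul,
    Complex.exp_ofReal_mul_I_re]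

/-- Writing `1 / (δ + it)` as a Laplace transform, the pole acts as if prime powers were spread on
the logarithmic scale with density `exp (-δ v)` after weighting. -/
theorem integral_pole_eq {δ T : ℝ} (hδ : 0 < δ) (hT : 0 < T) (y : ℝ) :
    2 * ∫ t in (0 : ℝ)..T, (1 - t / T) *
        (Complex.exp (t * y * Complex.I) * (1 / (δ + t * Complex.I))).re =
      ∫ v in Ioi (0 : ℝ), Real.exp (-δ * v) * fejer T (y - v) := by
  simp_rw [re_exp_div_eq_integral hδ, ← integral_const_mul]
  rw [intervalIntegral.integral_of_le hT.le, integral_integral_swap, ← integral_const_mul]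
  · refine integral_congr_ae (Filter.Eventually.of_forall fun v => ?_)
    simp only
    rw [fejer, mul_left_comm, intervalIntegral.integral_of_le hT.le,
      ← integral_const_mul (Real.exp (-δ * v))]
    congr 2
    ext t
    ring
  · have h1 : Integrable (fun _ : ℝ => (1 : ℝ)) (volume.restrict (Ioc 0 T)) := by simp
    have h2 : Integrable (fun v : ℝ => Real.exp (-δ * v)) (volume.restrict (Ioi 0)) :=
      integrableOn_exp_mul_Ioi (by simpa using hδ) 0
    refine (h1.mul_prod h2).mono' ?_ ?_
    · apply Continuous.aestronglyMeasurable
      fun_prop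
    · rw [Measure.prod_restrict]
      refine (ae_restrict_mem (measurableSet_Ioc.prod measurableSet_Ioi)).mono ?_
      rintro ⟨t, v⟩ ⟨⟨ht0, htT⟩, -⟩
      simp only [Function.uncurry, Real.norm_eq_abs, abs_mul, Real.abs_exp]
      have h1 : |1 - t / T| ≤ 1 := by
        have : t / T ≤ 1 := by rw [div_le_one hT]; exact htT
        have : 0 ≤ t / T := div_nonneg ht0.le hT.le
        rw [abs_le]; constructor <;> linarith
      gcongr
      calc _ ≤ Real.exp (-δ * v) * 1 := by
            gcongr
            exact Real.abs_cos_le_one _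
        _ = _ := mul_one _

theorem le_integral_exp_mul_fejer {δ T y : ℝ} (hδ : 0 < δ) (hT : 0 < T) (hy : 1 / T ≤ y) :
    Real.exp (-δ * y) / 2 ≤ ∫ v in Ioi (0 : ℝ), Real.exp (-δ * v) * fejer T (y - v) := by
  have hint : IntegrableOn (fun v => Real.exp (-δ * v) * fejer T (y - v)) (Ioi 0) := by
    have h2 : IntegrableOn (fun v : ℝ => Real.exp (-δ * v)) (Ioi 0) :=
      integrableOn_exp_mul_Ioi (by simpa using hδ) 0
    refine Integrable.mono' (h2.integrable.const_mul (2 * T)) ?_ ?_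
    · apply Continuous.aestronglyMeasurable
      exact (by fun_prop : Continuous fun v => Real.exp (-δ * v)).mul
        ((continuous_fejer T).comp (by fun_prop))
    · refine Filter.Eventually.of_forall fun v => ?_
      rw [norm_mul, Real.norm_eq_abs, Real.abs_exp, mul_comm]
      gcongr
      rw [Real.norm_eq_abs, fejer, abs_mul, abs_two]
      gcongr
      have := intervalIntegral.norm_integral_le_of_norm_le_const (a := 0) (b := T) (C := 1)
        (f := fun t => (1 - t / T) * Real.cos (t * (y - v))) (by
          intro t ht
          rw [uIoc_of_le hT.le] at ht
          rw [Real.norm_eq_abs, abs_mul]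
          have h1 : |1 - t / T| ≤ 1 := by
            have : t / T ≤ 1 := by rw [div_le_one hT]; exact ht.2
            have : 0 ≤ t / T := div_nonneg ht.1.le hT.le
            rw [abs_le]; constructor <;> linarith
          exact mul_le_one₀ h1 (abs_nonneg _) (Real.abs_cos_le_one _))
      simpa [abs_of_pos hT] using this
  -- On this window of length `1 / T` the kernel is at least `T / 2`; positivity allows the rest to
  -- be discarded.
  have hsub : Ioc (y - 1 / T) y ⊆ Ioi 0 := fun v hv => lt_of_le_of_lt (by linarith) hv.1
  calc Real.exp (-δ * y) / 2 = ∫ v in Ioc (y - 1 / T) y, Real.exp (-δ * y) * (T / 2) := by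
        rw [setIntegral_const, smul_eq_mul, Real.volume_real_Ioc_of_le (by simp [hT.le])]
        field_simp
        ring
    _ ≤ ∫ v in Ioc (y - 1 / T) y, Real.exp (-δ * v) * fejer T (y - v) := by
        refine setIntegral_mono_on (integrableOn_const (by simp)) (hint.mono_set hsub) measurableSet_Ioc fun v hv => ?_
        have h1 := le_fejer hT (u := y - v) (by
          rw [abs_of_nonneg (by linarith [hv.2])]; linarith [hv.1])
        have : v ≤ y := hv.2
        gcongr Real.exp ?_ * ?_
        nlinarith
    _ ≤ _ := by
        refine setIntegral_mono_set hint ?_ hsub.eventuallyLE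
        exact Filter.Eventually.of_forall fun v =>
          mul_nonneg (Real.exp_pos _).le (fejer_nonneg hT _)

-- Continuity up to the line `Re s = 1` encodes the nonvanishing of zeta there. Modulus `1` makes
-- the residue class all of `ℕ`.
open ArithmeticFunction in
theorem exists_continuousOn_LSeries_vonMangoldt :
    ∃ G : ℂ → ℂ, ContinuousOn G {s | 1 ≤ s.re} ∧
      ∀ s : ℂ, 1 < s.re → LSeries (fun n => (Λ n : ℂ)) s = G s + 1 / (s - 1) := by
  refine ⟨vonMangoldt.LFunctionResidueClassAux (q := 1) 1,
    vonMangoldt.continuousOn_LFunctionResidueClassAux 1, fun s hs => ?_⟩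
  have h := vonMangoldt.eqOn_LFunctionResidueClassAux (q := 1) (a := 1) isUnit_one hs
  simp only at h
  rw [h]
  have : (fun n : ℕ => ((vonMangoldt.residueClass (1 : ZMod 1) n : ℝ) : ℂ)) =
      fun n => (Λ n : ℂ) := by
    ext n
    rw [vonMangoldt.residueClass, Set.indicator_of_mem]
    exact Subsingleton.elim _ _
  rw [this]
  simp

-- Let `δ → 0+`: the pole keeps a contribution of at least `1/2`, while the continuous part
-- converges to its boundary integral.
open ArithmeticFunction in
theorem half_add_integral_le {G : ℂ → ℂ} (hG : ContinuousOn G {s | 1 ≤ s.re})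
    (hL : ∀ s : ℂ, 1 < s.re → LSeries (fun n => (Λ n : ℂ)) s = G s + 1 / (s - 1))
    {T y M : ℝ} (hT : 0 < T) (hy : 1 / T ≤ y)
    (hM : ∀ δ : ℝ, 0 < δ → ∑' n : ℕ, Λ n / (n : ℝ) ^ (1 + δ) * fejer T (y - Real.log n) ≤ M) :
    1 / 2 + 2 * ∫ t in (0 : ℝ)..T, (1 - t / T) *
      (Complex.exp (t * y * Complex.I) * G (1 + t * Complex.I)).re ≤ M := by
  have hpath : Continuous fun p : ℝ × ℝ => G (1 + (max p.1 0 : ℝ) + p.2 * Complex.I) := by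
    apply hG.comp_continuous
    · fun_prop
    · intro p; simp
  -- Truncating `δ` at `0` keeps the argument in the closed half-plane, so `R` is continuous on all
  -- of `ℝ`.
  let R : ℝ → ℝ := fun δ => 2 * ∫ t in (0 : ℝ)..T, (1 - t / T) *
      (Complex.exp (t * y * Complex.I) * G (1 + (max δ 0 : ℝ) + t * Complex.I)).re
  have hR : Continuous R := by
    apply Continuous.mul continuous_const
    apply intervalIntegral.continuous_parametric_intervalIntegral_of_continuous' (f := fun δ t =>
      (1 - t / T) * (Complex.exp (t * y * Complex.I) *
        G (1 + (max δ 0 : ℝ) + t * Complex.I)).re)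
    refine Continuous.mul (by fun_prop) (Complex.continuous_re.comp (Continuous.mul ?_ hpath))
    fun_prop
  have key : ∀ δ > 0, Real.exp (-δ * y) / 2 + R δ ≤ M := by
    intro δ hδ
    refine le_trans ?_ (hM δ hδ)
    rw [tsum_vonMangoldt_mul_fejer hδ hT]
    have hsplit : ∀ t : ℝ, (1 - t / T) * (Complex.exp (t * y * Complex.I) *
        LSeries (fun n => (Λ n : ℂ)) (1 + δ + t * Complex.I)).re =
        (1 - t / T) * (Complex.exp (t * y * Complex.I) * (1 / (δ + t * Complex.I))).re +
        (1 - t / T) * (Complex.exp (t * y * Complex.I) *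
          G (1 + (max δ 0 : ℝ) + t * Complex.I)).re := by
      intro t
      rw [hL _ (by simpa using hδ), max_eq_left hδ.le, ← mul_add, ← Complex.add_re, ← mul_add]
      congr 3
      rw [add_comm]
      congr 3
      ring
    simp_rw [hsplit]
    rw [intervalIntegral.integral_add, mul_add, integral_pole_eq hδ hT]
    · exact add_le_add_left (le_integral_exp_mul_fejer hδ hT hy) _
    · apply Continuous.intervalIntegrable
      refine Continuous.mul (by fun_prop) (Complex.continuous_re.comp (Continuous.mul ?_ ?_))
      · fun_prop
      · refine Continuous.div continuous_const (by fun_prop) fun t h => ?_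
        have := congrArg Complex.re h
        simp at this
        exact hδ.ne' this
    · apply Continuous.intervalIntegrable
      refine Continuous.mul (by fun_prop) (Complex.continuous_re.comp (Continuous.mul ?_ ?_))
      · fun_prop
      · exact hpath.comp (continuous_const.prodMk continuous_id)
  have hlim : Tendsto (fun δ => Real.exp (-δ * y) / 2 + R δ) (nhdsWithin 0 (Ioi 0))
      (nhds (Real.exp (-0 * y) / 2 + R 0)) := by
    apply Tendsto.mono_left _ nhdsWithin_le_nhds
    exact (Continuous.add (by fun_prop) hR).tendsto 0
  have := le_of_tendsto hlim (eventually_nhdsWithin_of_forall key)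
  simpa [R] using this

theorem tendsto_integral_exp_mul {G : ℂ → ℂ} (hG : ContinuousOn G {s | 1 ≤ s.re})
    {T : ℝ} (hT : 0 < T) :
    Tendsto (fun y : ℝ => ∫ t in (0 : ℝ)..T, (1 - t / T) *
      (Complex.exp (t * y * Complex.I) * G (1 + t * Complex.I)).re) atTop (nhds 0) := by
  let g : ℝ → ℂ := fun t => (1 - t / T : ℝ) * G (1 + t * Complex.I)
  have hpath : Continuous fun t : ℝ => G (1 + t * Complex.I) := by
    apply hG.comp_continuous
    · fun_prop
    · intro p; simp
  have hRL := Real.tendsto_integral_exp_smul_cocompact ((Ioc 0 T).indicator g)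
  have hφ : Tendsto (fun y : ℝ => -(2 * Real.pi)⁻¹ * y) atTop (cocompact ℝ) := by
    refine Tendsto.mono_right ?_ atBot_le_cocompact
    refine tendsto_id.const_mul_atTop_of_neg ?_
    have := Real.pi_pos
    simp only [Left.neg_neg_iff]
    positivity
  have h := (Complex.continuous_re.tendsto 0).comp (hRL.comp hφ)
  rw [Complex.zero_re] at h
  refine h.congr fun y => ?_
  simp only [Function.comp]
  have h1 : ∀ v : ℝ, Real.fourierChar (-(v * (-(2 * Real.pi)⁻¹ * y))) •
      (Ioc 0 T).indicator g v =
      (Ioc 0 T).indicator (fun v : ℝ => Complex.exp (v * y * Complex.I) * g v) v := by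
    intro w
    by_cases hw : w ∈ Ioc 0 T
    · rw [indicator_of_mem hw, indicator_of_mem hw, Circle.smul_def, Real.fourierChar_apply,
        smul_eq_mul]
      congr 2
      push_cast
      field_simp
    · rw [indicator_of_notMem hw, indicator_of_notMem hw, smul_zero]
  simp_rw [h1]
  rw [integral_indicator measurableSet_Ioc, intervalIntegral.integral_of_le hT.le]
  have hint : IntegrableOn (fun v : ℝ => Complex.exp (v * y * Complex.I) * g v) (Ioc 0 T) := by
    apply (Continuous.integrableOn_Icc ?_).mono_set Ioc_subset_Icc_self
    exact Continuous.mul (by fun_prop) (Continuous.mul (by fun_prop) hpath)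
  have h4 := Complex.reCLM.integral_comp_comm hint.integrable
  simp only [Complex.reCLM_apply] at h4
  rw [← h4]
  refine integral_congr_ae (Filter.Eventually.of_forall fun v => ?_)
  simp only [g]
  rw [mul_left_comm, Complex.re_ofReal_mul]

end TraceTuran

/-! ### Prime powers in short intervals -/

namespace TraceTuran

open MeasureTheory Set Filter

theorem summable_inv_one_add_sq_int : Summable fun j : ℤ => 1 / (1 + (j : ℝ) ^ 2) := by
  refine Summable.of_nonneg_of_le (fun j => by positivity) (fun j => ?_)
    (((Real.summable_one_div_int_pow (p := 2)).2 one_lt_two).add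
      ((hasSum_ite_eq (0 : ℤ) (1 : ℝ)).summable))
  rcases eq_or_ne j 0 with rfl | hj
  · simp
  · have : (0 : ℝ) < (j : ℝ) ^ 2 := by positivity
    simp only [hj, if_false, add_zero]
    gcongr
    linarith

open ArithmeticFunction in
theorem sum_vonMangoldt_div_le (s : Finset ℕ) (k : ℕ)
    (hs : ∀ n ∈ s, ⌊Real.log n⌋₊ = k) :
    ∑ n ∈ s, Λ n / n ≤ (Real.log 4 + 4) * Real.exp 1 := by
  have h1 : ∀ n ∈ s, Λ n / n ≤ Λ n / Real.exp k := by
    intro n hn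
    rcases eq_or_ne n 0 with rfl | h0
    · simp
    · have : Real.exp k ≤ n := by
        rw [← Real.le_log_iff_exp_le (by positivity), ← hs n hn]
        exact Nat.floor_le (Real.log_natCast_nonneg n)
      have h : 0 ≤ Λ n := vonMangoldt_nonneg
      gcongr
  have h2 : ∑ n ∈ s, Λ n ≤ Chebyshev.psi (Real.exp (k + 1)) := by
    unfold Chebyshev.psi
    -- Since `Real.log 0 = 0`, the block `k = 0` may contain `n = 0`; its weight vanishes.
    rw [← Finset.sum_erase s (a := 0) (by simp)]
    refine Finset.sum_le_sum_of_subset_of_nonneg (fun n hn => ?_) fun n _ _ => vonMangoldt_nonneg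
    obtain ⟨hn0, hn⟩ := Finset.mem_erase.1 hn
    rw [Finset.mem_Ioc]
    refine ⟨Nat.pos_of_ne_zero hn0, ?_⟩
    rw [Nat.le_floor_iff (Real.exp_pos _).le, ← Real.log_le_iff_le_exp (by positivity), ← hs n hn]
    exact (Nat.lt_floor_add_one _).le
  calc ∑ n ∈ s, Λ n / n ≤ ∑ n ∈ s, Λ n / Real.exp k := Finset.sum_le_sum h1
    _ = (∑ n ∈ s, Λ n) / Real.exp k := by rw [Finset.sum_div]
    _ ≤ (Real.log 4 + 4) * Real.exp (k + 1) / Real.exp k := by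
        gcongr
        exact h2.trans (Chebyshev.psi_le_const_mul_self (Real.exp_pos _).le)
    _ = _ := by rw [Real.exp_add]; field_simp

-- Chebyshev's bound gives each block `⌊log n⌋₊ = k` bounded mass, and the blocks are then summed
-- against a convergent series. Uniformity in `y` and `δ` is the point.
open ArithmeticFunction in
theorem exists_tsum_vonMangoldt_le :
    ∃ B : ℝ, 0 ≤ B ∧ ∀ (y δ : ℝ), 0 < δ →
      ∑' n : ℕ, Λ n / (n : ℝ) ^ (1 + δ) * (1 / (1 + (y - Real.log n) ^ 2)) ≤ B := by
  set C : ℝ := (Real.log 4 + 4) * Real.exp 1 with hC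
  have hC0 : 0 ≤ C := by
    have : 0 ≤ Real.log 4 := Real.log_nonneg (by norm_num)
    positivity
  have hZ0 : 0 ≤ ∑' j : ℤ, 1 / (1 + (j : ℝ) ^ 2) := tsum_nonneg fun j => by positivity
  refine ⟨3 * C * ∑' j : ℤ, 1 / (1 + (j : ℝ) ^ 2), by positivity, fun y δ hδ => ?_⟩
  refine Real.tsum_le_of_sum_le (fun n => ?_) fun s => ?_
  · have : 0 ≤ Λ n := vonMangoldt_nonneg
    positivity
  have hterm : ∀ n : ℕ, Λ n / (n : ℝ) ^ (1 + δ) * (1 / (1 + (y - Real.log n) ^ 2)) ≤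
      Λ n / n * (3 * (1 / (1 + (((⌊Real.log n⌋₊ : ℤ) - ⌊y⌋ : ℤ) : ℝ) ^ 2))) := by
    intro n
    rcases eq_or_ne n 0 with rfl | h0
    · simp
    have hn1 : (1 : ℝ) ≤ n := by exact_mod_cast Nat.one_le_iff_ne_zero.2 h0
    have h : 0 ≤ Λ n := vonMangoldt_nonneg
    have hp : (n : ℝ) ≤ (n : ℝ) ^ (1 + δ) := by
      calc (n : ℝ) = (n : ℝ) ^ (1 : ℝ) := (Real.rpow_one _).symm
        _ ≤ _ := Real.rpow_le_rpow_of_exponent_le hn1 (by linarith)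
    have hsq : 1 / (1 + (y - Real.log n) ^ 2) ≤
        3 * (1 / (1 + (((⌊Real.log n⌋₊ : ℤ) - ⌊y⌋ : ℤ) : ℝ) ^ 2)) := by
      rw [mul_one_div, div_le_div_iff₀ (by positivity) (by positivity)]
      push_cast
      have a1 := Nat.floor_le (Real.log_natCast_nonneg n)
      have a2 := Nat.lt_floor_add_one (Real.log n)
      have a3 := Int.floor_le y
      have a4 := Int.lt_floor_add_one y
      set a : ℝ := (⌊Real.log n⌋₊ : ℝ)
      set b : ℝ := (⌊y⌋ : ℝ)
      have e1 : |(a - b) - (Real.log n - y)| ≤ 1 := by rw [abs_le]; constructor <;> linarith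
      have e2 := sq_abs ((a - b) - (Real.log n - y))
      have e3 : ((a - b) - (Real.log n - y)) ^ 2 ≤ 1 := by
        rw [← e2]; exact pow_le_one₀ (abs_nonneg _) e1
      -- Rounding moves the difference by at most `1`, so its square is at most twice the old square
      -- plus `2`; hence the factor `3`.
      nlinarith [sq_nonneg ((a - b) - 2 * (Real.log n - y))]
    gcongr
  have hZ : ∀ t : Finset ℕ, ∑ k ∈ t, 1 / (1 + (((k : ℤ) - ⌊y⌋ : ℤ) : ℝ) ^ 2) ≤
      ∑' j : ℤ, 1 / (1 + (j : ℝ) ^ 2) := by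
    intro t
    have hinj : Function.Injective fun k : ℕ => (k : ℤ) - ⌊y⌋ := fun a b h => by
      simpa using h
    rw [← Finset.sum_image (s := t) (g := fun k : ℕ => (k : ℤ) - ⌊y⌋)
      (f := fun j : ℤ => 1 / (1 + (j : ℝ) ^ 2)) hinj.injOn]
    exact summable_inv_one_add_sq_int.sum_le_tsum _ fun j _ => by positivity
  calc ∑ n ∈ s, Λ n / (n : ℝ) ^ (1 + δ) * (1 / (1 + (y - Real.log n) ^ 2))
      ≤ ∑ n ∈ s, Λ n / n * (3 * (1 / (1 + (((⌊Real.log n⌋₊ : ℤ) - ⌊y⌋ : ℤ) : ℝ) ^ 2))) :=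
        Finset.sum_le_sum fun n _ => hterm n
    _ = ∑ k ∈ s.image (fun n : ℕ => ⌊Real.log n⌋₊), ∑ n ∈ s.filter fun n : ℕ => ⌊Real.log n⌋₊ = k,
          Λ n / n * (3 * (1 / (1 + (((⌊Real.log n⌋₊ : ℤ) - ⌊y⌋ : ℤ) : ℝ) ^ 2))) :=
        (Finset.sum_fiberwise_of_maps_to (fun n hn => Finset.mem_image_of_mem _ hn) _).symm
    _ ≤ ∑ k ∈ s.image (fun n : ℕ => ⌊Real.log n⌋₊),
          3 * C * (1 / (1 + (((k : ℤ) - ⌊y⌋ : ℤ) : ℝ) ^ 2)) := by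
        refine Finset.sum_le_sum fun k _ => ?_
        have : ∑ n ∈ s.filter fun n : ℕ => ⌊Real.log n⌋₊ = k,
            Λ n / n * (3 * (1 / (1 + (((⌊Real.log n⌋₊ : ℤ) - ⌊y⌋ : ℤ) : ℝ) ^ 2))) =
            (∑ n ∈ s.filter fun n : ℕ => ⌊Real.log n⌋₊ = k, Λ n / n) *
              (3 * (1 / (1 + (((k : ℤ) - ⌊y⌋ : ℤ) : ℝ) ^ 2))) := by
          rw [Finset.sum_mul]
          refine Finset.sum_congr rfl fun n hn => ?_
          rw [(Finset.mem_filter.1 hn).2]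
        rw [this, mul_comm 3 C, mul_assoc]
        gcongr
        exact sum_vonMangoldt_div_le _ k fun n hn => (Finset.mem_filter.1 hn).2
    _ ≤ _ := by
        rw [← Finset.mul_sum]
        gcongr
        exact hZ _

open ArithmeticFunction in
/-- Short intervals contain prime powers: every window of fixed logarithmic width does,
far enough out. -/
theorem exists_vonMangoldt_ne_zero_near {η : ℝ} (hη : 0 < η) :
    ∃ Y : ℝ, ∀ y ≥ Y, ∃ n : ℕ, Λ n ≠ 0 ∧ |y - Real.log n| < η := by
  wlog hη1 : η ≤ 1 generalizing η
  · obtain ⟨Y, hY⟩ := this one_pos le_rfl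
    exact ⟨Y, fun y hy => (hY y hy).imp fun n hn => ⟨hn.1, hn.2.trans (not_le.1 hη1)⟩⟩
  obtain ⟨B, hB0, hB⟩ := exists_tsum_vonMangoldt_le
  obtain ⟨G, hG, hL⟩ := exists_continuousOn_LSeries_vonMangoldt
  -- With this `T`, a gap of radius `η` forces the smoothed sum below `8 * B / (T * η ^ 2) ≤ 1/8`,
  -- while for large `y` it must exceed `1/2 - 2/8`.
  set T : ℝ := 64 * (B + 1) / η ^ 2 with hTdef
  have hT : 0 < T := by positivity
  have hlim := tendsto_integral_exp_mul hG hT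
  obtain ⟨Y, hY⟩ := eventually_atTop.1
    (hlim.eventually (lt_mem_nhds (show (-1 / 8 : ℝ) < 0 by norm_num)))
  refine ⟨max Y (1 / T), fun y hy => ?_⟩
  by_contra! hgap
  have hbound : ∀ δ : ℝ, 0 < δ →
      ∑' n : ℕ, Λ n / (n : ℝ) ^ (1 + δ) * fejer T (y - Real.log n) ≤ 1 / 8 := by
    intro δ hδ
    have hle : ∀ n : ℕ, Λ n / (n : ℝ) ^ (1 + δ) * fejer T (y - Real.log n) ≤
        8 / (T * η ^ 2) * (Λ n / (n : ℝ) ^ (1 + δ) * (1 / (1 + (y - Real.log n) ^ 2))) := by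
      intro n
      by_cases h0 : Λ n = 0
      · simp [h0]
      have hg := hgap n h0
      have hpos : 0 < |y - Real.log n| := hη.trans_le hg
      have h : 0 ≤ Λ n / (n : ℝ) ^ (1 + δ) := div_nonneg vonMangoldt_nonneg (by positivity)
      have h1 := fejer_le hT (abs_pos.1 hpos)
      have h2 : 4 / (T * (y - Real.log n) ^ 2) ≤
          8 / (T * η ^ 2) * (1 / (1 + (y - Real.log n) ^ 2)) := by
        rw [← sq_abs (y - Real.log n)]
        rw [div_mul_div_comm, mul_one, div_le_div_iff₀ (by positivity) (by positivity)]
        have e1 : η ^ 2 ≤ |y - Real.log n| ^ 2 := by gcongr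
        have e2 : η ^ 2 ≤ 1 := pow_le_one₀ hη.le hη1
        have e3 : η ^ 2 * (1 + |y - Real.log n| ^ 2) ≤ 2 * |y - Real.log n| ^ 2 := by
          nlinarith [sq_nonneg |y - Real.log n|]
        nlinarith
      calc _ ≤ Λ n / (n : ℝ) ^ (1 + δ) * (8 / (T * η ^ 2) * (1 / (1 + (y - Real.log n) ^ 2))) := by
            gcongr
            exact h1.trans h2
        _ = _ := by ring
    have hsum : Summable fun n : ℕ =>
        Λ n / (n : ℝ) ^ (1 + δ) * (1 / (1 + (y - Real.log n) ^ 2)) := by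
      refine Summable.of_nonneg_of_le (fun n => ?_) (fun n => ?_) (summable_vonMangoldt_div_rpow hδ)
      · have : 0 ≤ Λ n := vonMangoldt_nonneg
        positivity
      · have h : 0 ≤ Λ n / (n : ℝ) ^ (1 + δ) := div_nonneg vonMangoldt_nonneg (by positivity)
        refine mul_le_of_le_one_right h ?_
        rw [div_le_one (by positivity)]
        nlinarith [sq_nonneg (y - Real.log n)]
    have hsum' := hsum.mul_left (8 / (T * η ^ 2))
    calc _ ≤ ∑' n : ℕ, 8 / (T * η ^ 2) *
          (Λ n / (n : ℝ) ^ (1 + δ) * (1 / (1 + (y - Real.log n) ^ 2))) := by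
          refine Summable.tsum_le_tsum hle ?_ hsum'
          refine Summable.of_nonneg_of_le (fun n => ?_) hle hsum'
          exact mul_nonneg (div_nonneg vonMangoldt_nonneg (by positivity)) (fejer_nonneg hT _)
      _ ≤ 8 / (T * η ^ 2) * B := by
          rw [tsum_mul_left]
          gcongr
          exact hB y δ hδ
      _ ≤ 1 / 8 := by
          rw [hTdef, div_mul_cancel₀ _ (by positivity), div_mul_eq_mul_div,
            div_le_div_iff₀ (by positivity) (by norm_num)]
          linarith
  have h1 := half_add_integral_le hG hL hT ((le_max_right _ _).trans hy) hbound
  have h2 := hY y ((le_max_left _ _).trans hy)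
  linarith

open ArithmeticFunction in
/-- For large real `x` there is a prime power in `((1 - ε) x, x]`. -/
theorem exists_isPrimePow_between {ε : ℝ} (hε : 0 < ε) (hε1 : ε < 1) :
    ∃ X : ℝ, ∀ x ≥ X, ∃ q : ℕ, IsPrimePow q ∧ (1 - ε) * x ≤ q ∧ (q : ℝ) ≤ x := by
  -- The interval from `(1 - ε) x` to `x` has logarithmic length `2 * η`, with centre `log x - η`.
  set η : ℝ := -Real.log (1 - ε) / 2 with hη
  have hη0 : 0 < η := by
    have := Real.log_neg (by linarith : 0 < 1 - ε) (by linarith)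
    rw [hη]; linarith
  obtain ⟨Y, hY⟩ := exists_vonMangoldt_ne_zero_near hη0
  refine ⟨Real.exp (Y + η), fun x hx => ?_⟩
  have hx0 : 0 < x := (Real.exp_pos _).trans_le hx
  have hlog : Y + η ≤ Real.log x := (Real.le_log_iff_exp_le hx0).2 hx
  obtain ⟨q, hq, hq2⟩ := hY (Real.log x - η) (by linarith)
  rw [vonMangoldt_ne_zero_iff] at hq
  have hq0 : (0 : ℝ) < q := by exact_mod_cast hq.pos
  rw [abs_lt] at hq2
  refine ⟨q, hq, ?_, ?_⟩
  · rw [← Real.log_le_log_iff (mul_pos (by linarith) hx0) hq0,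
      Real.log_mul (by linarith) hx0.ne']
    linarith [hq2.1, hq2.2]
  · rw [← Real.log_le_log_iff hq0 hx0]
    linarith [hq2.1, hq2.2]

end TraceTuran

/-! ### Traces of the four-cycle and the polarity construction -/

namespace TraceTuran

open Set

theorem edgeSet_image_cycleFour {β : Type*} (f : Fin 4 → β) :
    E(cycleFour.image f) = range fun i : Fin 4 => ({f i, f (i + 1)} : Set β) := by
  have hadj : ∀ u v : Fin 4, (SimpleGraph.cycleGraph 4).Adj u v ↔ v = u + 1 ∨ u = v + 1 := by
    decide
  ext s
  simp only [Hypergraph.image_edgeSet, cycleFour, ofSimpleGraph, mem_image, mem_ofPred_eq, mem_range]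
  constructor
  · rintro ⟨_, ⟨u, v, huv, rfl⟩, rfl⟩
    rcases (hadj u v).1 huv with rfl | rfl
    · exact ⟨u, by rw [image_pair]⟩
    · exact ⟨v, by rw [image_pair, pair_comm]⟩
  · rintro ⟨i, rfl⟩
    exact ⟨{i, i + 1}, ⟨i, i + 1, (hadj _ _).2 (.inl rfl), rfl⟩, by rw [image_pair]⟩

theorem cyclic_pair_injective {β : Type*} {f : Fin 4 → β} (hf : Function.Injective f) :
    Function.Injective fun i : Fin 4 => ({f i, f (i + 1)} : Set β) := by
  have h4 : ∀ i j : Fin 4, (i = j ∨ i = j + 1) → (i + 1 = j ∨ i + 1 = j + 1) → i = j := by decide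
  intro i j hij
  have h1 : f i ∈ ({f j, f (j + 1)} : Set β) := by
    rw [← show ({f i, f (i + 1)} : Set β) = {f j, f (j + 1)} from hij]; simp
  have h2 : f (i + 1) ∈ ({f j, f (j + 1)} : Set β) := by
    rw [← show ({f i, f (i + 1)} : Set β) = {f j, f (j + 1)} from hij]; simp
  simp only [mem_insert_iff, mem_singleton_iff, hf.eq_iff] at h1 h2
  exact h4 i j h1 h2

/-- A hypergraph contains the four-cycle as a trace iff there are four vertices in cyclic order and
four edges that meet them in the pairs of cyclically consecutive vertices. -/
theorem containsTrace_cycleFour_iff {β : Type*} {H : Hypergraph β} :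
    ContainsTrace H cycleFour ↔ ∃ f : Fin 4 → β, Function.Injective f ∧
      (∀ i, f i ∈ V(H)) ∧ ∃ e : Fin 4 → Set β,
        ∀ i, e i ∈ E(H) ∧ e i ∩ range f = {f i, f (i + 1)} := by
  have hV : ∀ f : Fin 4 → β, V(cycleFour.image f) = range f := fun f => by
    simp [cycleFour, ofSimpleGraph]
  constructor
  · rintro ⟨f, hf, T, ⟨hTV, hTE⟩, hFV, φ, hφ⟩
    have hf' : Function.Injective f := by
      rw [← injOn_univ]; exact hf
    have hmem : ∀ i : Fin 4, ({f i, f (i + 1)} : Set β) ∈ E(cycleFour.image f) := fun i => by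
      rw [edgeSet_image_cycleFour]; exact ⟨i, rfl⟩
    refine ⟨f, hf', fun i => hTV (hFV ?_), fun i => φ ⟨_, hmem i⟩, fun i => ⟨hTE (φ _).2, ?_⟩⟩
    · rw [hV]; exact mem_range_self i
    · have := hφ ⟨_, hmem i⟩
      rwa [hV] at this
  · rintro ⟨f, hf, hfV, e, he⟩
    have hpair := cyclic_pair_injective hf
    -- Distinct cyclic pairs are distinct traces, so the four edges are automatically distinct.
    have heinj : Function.Injective e := fun i j hij => hpair (by
      simp only
      rw [← (he i).2, ← (he j).2, hij])
    refine ⟨f, hf.injOn, ⟨V(H), range e, ?_⟩, ⟨Subset.rfl, ?_⟩, ?_, ?_⟩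
    · rintro _ ⟨i, rfl⟩
      exact H.subset_vertexSet_of_mem_edgeSet (he i).1
    · rintro _ ⟨i, rfl⟩
      exact (he i).1
    · rw [hV]
      rintro _ ⟨i, rfl⟩
      exact hfV i
    · refine ⟨(Equiv.setCongr (edgeSet_image_cycleFour f)).trans
        ((Equiv.ofInjective _ hpair).symm.trans (Equiv.ofInjective e heinj)), ?_⟩
      rintro ⟨s, hs⟩
      have hs' := hs
      rw [edgeSet_image_cycleFour] at hs'
      obtain ⟨i, rfl⟩ := hs'
      have : (Equiv.ofInjective _ hpair).symm ⟨{f i, f (i + 1)}, ⟨i, rfl⟩⟩ = i :=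
        Equiv.ofInjective_symm_apply hpair i
      rw [hV]
      simp only [Equiv.trans_apply, Equiv.setCongr_apply, this, Equiv.ofInjective_apply]
      exact (he i).2

theorem bddAbove_exTrace {α : Type*} (n r : ℕ) (F : Hypergraph α) :
    BddAbove {m : ℕ | ∃ H : Hypergraph (Fin n), V(H) = Set.univ ∧ IsUniform H r ∧
      ¬ ContainsTrace H F ∧ E(H).ncard = m} := by
  refine ⟨(univ : Set (Set (Fin n))).ncard, ?_⟩
  rintro _ ⟨H, -, -, -, rfl⟩
  exact ncard_le_ncard (subset_univ _)

theorem ncard_edgeSet_le_exTrace {α : Type*} {n r : ℕ} {F : Hypergraph α} {H : Hypergraph (Fin n)}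
    (hV : V(H) = univ) (hr : IsUniform H r) (hF : ¬ ContainsTrace H F) :
    E(H).ncard ≤ exTrace n r F :=
  le_csSup (bddAbove_exTrace n r F) ⟨H, hV, hr, hF, rfl⟩

/-- The cone over the affine polarity graph of a field `K`: the vertices are the points of the plane
and an apex, and the edges consist of the apex and two distinct points `(x, y)`, `(x', y')` with
`y + y' = x * x'`. It is transported along a map `ι`. -/
def polarityCone {K β : Type*} [Field K] (ι : Option (K × K) → β) : Hypergraph β where
  vertexSet := univ
  edgeSet := {s | ∃ p p' : K × K, p ≠ p' ∧ p.2 + p'.2 = p.1 * p'.1 ∧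
    s = {ι none, ι (some p), ι (some p')}}
  subset_vertexSet_of_mem_edgeSet' := fun _ _ => subset_univ _

theorem isUniform_polarityCone {K β : Type*} [Field K] {ι : Option (K × K) → β}
    (hι : Function.Injective ι) : IsUniform (polarityCone ι) 3 := by
  rintro s ⟨p, p', hne, -, rfl⟩
  have := encard_eq_three.2 ⟨ι none, ι (some p), ι (some p'), by simp [hι.eq_iff],
    by simp [hι.eq_iff], by simpa [hι.eq_iff] using hne, rfl⟩
  exact this

theorem not_containsTrace_polarityCone {K β : Type*} [Field K] {ι : Option (K × K) → β}
    (hι : Function.Injective ι) : ¬ ContainsTrace (polarityCone ι) cycleFour := by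
  rw [containsTrace_cycleFour_iff]
  rintro ⟨f, hf, -, e, he⟩
  have hrot : ∀ j : Fin 4, j ≠ j + 1 ∧ j ≠ j + 1 + 1 := by decide
  have hapex : ∀ i, ι none ∈ e i := by
    intro i
    obtain ⟨p, p', -, -, h⟩ := (he i).1
    rw [h]; simp
  -- Edge `j + 1` must miss `f j`, yet it contains the apex.
  have hz : ∀ j, f j ≠ ι none := by
    intro j hj
    have : f j ∈ e (j + 1) ∩ range f := ⟨hj ▸ hapex (j + 1), mem_range_self j⟩
    rw [(he (j + 1)).2] at this
    simp only [mem_insert_iff, mem_singleton_iff, hf.eq_iff] at this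
    exact this.elim (hrot j).1 (hrot j).2
  have hedge : ∀ i, ∃ p p' : K × K, f i = ι (some p) ∧ f (i + 1) = ι (some p') ∧
      p.2 + p'.2 = p.1 * p'.1 := by
    intro i
    obtain ⟨p, p', hne, hpp, h⟩ := (he i).1
    have hsub : ({f i, f (i + 1)} : Set β) ⊆ e i := by rw [← (he i).2]; exact inter_subset_left
    have h1 : f i ∈ e i := hsub (by simp)
    have h2 : f (i + 1) ∈ e i := hsub (by simp)
    rw [h] at h1 h2
    simp only [mem_insert_iff, mem_singleton_iff, hz, false_or] at h1 h2
    have hne' : f i ≠ f (i + 1) := fun h => (hrot i).1 (hf h)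
    rcases h1 with h1 | h1 <;> rcases h2 with h2 | h2
    · exact absurd (h1.trans h2.symm) hne'
    · exact ⟨p, p', h1, h2, hpp⟩
    · exact ⟨p', p, h1, h2, by rw [add_comm, mul_comm]; exact hpp⟩
    · exact absurd (h1.trans h2.symm) hne'
  choose g g' hg hg' hgg using hedge
  have hstep : ∀ i, g' i = g (i + 1) := fun i => by
    have := (hg' i).symm.trans (hg (i + 1))
    simpa using hι this
  have hginj : Function.Injective g := fun i j hij => hf (by rw [hg, hg, hij])
  simp only [hstep] at hgg
  have e0 := hgg 0
  have e1 := hgg 1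
  have e2 := hgg 2
  have e3 := hgg 3
  simp only [show (0 : Fin 4) + 1 = 1 from rfl, show (1 : Fin 4) + 1 = 2 from rfl,
    show (2 : Fin 4) + 1 = 3 from rfl, show (3 : Fin 4) + 1 = 0 from rfl] at e0 e1 e2 e3
  -- In the alternating sum of the four relations the second coordinates cancel.
  have hprod : ((g 0).1 - (g 2).1) * ((g 1).1 - (g 3).1) = 0 := by
    linear_combination -e0 + e1 - e2 + e3
  rcases mul_eq_zero.1 hprod with h | h
  · have hx : (g 0).1 = (g 2).1 := sub_eq_zero.1 h
    have hy : (g 0).2 = (g 2).2 := by linear_combination e0 - e1 + (g 1).1 * hx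
    exact absurd (hginj (Prod.ext hx hy)) (by decide)
  · have hx : (g 1).1 = (g 3).1 := sub_eq_zero.1 h
    have hy : (g 1).2 = (g 3).2 := by linear_combination e1 - e2 + (g 2).1 * hx
    exact absurd (hginj (Prod.ext hx hy)) (by decide)

theorem le_two_mul_ncard_polarityCone {K β : Type*} [Field K] [Fintype K] [Finite β]
    {ι : Option (K × K) → β} (hι : Function.Injective ι) :
    (Fintype.card K * Fintype.card K - Fintype.card K) * Fintype.card K ≤
      2 * E(polarityCone ι).ncard := by
  classical
  let S : Finset ((K × K) × K) := (Finset.univ : Finset K).offDiag ×ˢ Finset.univ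
  -- A pair is fixed by two distinct first coordinates and one second coordinate; an edge arises at
  -- most twice, once for each order.
  let pt : (K × K) × K → (K × K) × (K × K) := fun t =>
    ((t.1.1, t.2), (t.1.2, t.1.1 * t.1.2 - t.2))
  let edge : (K × K) × K → Set β := fun t =>
    {ι none, ι (some (pt t).1), ι (some (pt t).2)}
  have hpt : Function.Injective pt := by
    rintro ⟨⟨x, x'⟩, y⟩ ⟨⟨u, u'⟩, v⟩ h
    simp only [pt, Prod.mk.injEq] at h
    simp [h.1.1, h.1.2, h.2.1]
  have hcard : S.card = (Fintype.card K * Fintype.card K - Fintype.card K) * Fintype.card K := by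
    simp [S, Finset.offDiag_card]
  have hfib : ∀ s ∈ S.image edge, (S.filter fun t => edge t = s).card ≤ 2 := by
    intro s hs
    obtain ⟨t, -, rfl⟩ := Finset.mem_image.1 hs
    have : (S.filter fun t' => edge t' = edge t).image pt ⊆ {pt t, (pt t).swap} := by
      intro r hr
      obtain ⟨t', ht', rfl⟩ := Finset.mem_image.1 hr
      obtain ⟨hS', ht'⟩ := Finset.mem_filter.1 ht'
      have hS'' : t'.1.1 ≠ t'.1.2 := (Finset.mem_offDiag.1 (Finset.mem_product.1 hS').1).2.2
      have hne : (pt t').1 ≠ (pt t').2 := fun h => hS'' (congrArg Prod.fst h)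
      have h1 : ι (some (pt t').1) ∈ edge t := by rw [← ht']; simp [edge]
      have h2 : ι (some (pt t').2) ∈ edge t := by rw [← ht']; simp [edge]
      simp only [edge, mem_insert_iff, mem_singleton_iff, hι.eq_iff, reduceCtorEq,
        Option.some.injEq, false_or] at h1 h2
      simp only [Finset.mem_insert, Finset.mem_singleton]
      rcases h1 with h1 | h1 <;> rcases h2 with h2 | h2
      · exact absurd (h1.trans h2.symm) hne
      · exact .inl (Prod.ext h1 h2)
      · exact .inr (Prod.ext h1 h2)
      · exact absurd (h1.trans h2.symm) hne
    rw [← Finset.card_image_of_injective _ hpt]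
    exact (Finset.card_le_card this).trans Finset.card_le_two
  rw [← hcard]
  refine (Finset.card_le_mul_card_image S 2 hfib).trans ?_
  gcongr
  rw [← ncard_coe_finset]
  refine ncard_le_ncard ?_
  intro s hs
  obtain ⟨t, ht, rfl⟩ := Finset.mem_image.1 (Finset.mem_coe.1 hs)
  have hS'' : t.1.1 ≠ t.1.2 := (Finset.mem_offDiag.1 (Finset.mem_product.1 ht).1).2.2
  exact ⟨(pt t).1, (pt t).2, fun h => hS'' (congrArg Prod.fst h), by simp [pt], rfl⟩

theorem le_exTrace_of_field (K : Type*) [Field K] [Fintype K] {n : ℕ}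
    (hn : Fintype.card K ^ 2 + 1 ≤ n) :
    (Fintype.card K * Fintype.card K - Fintype.card K) * Fintype.card K ≤
      2 * exTrace n 3 cycleFour := by
  have hc : Fintype.card (Option (K × K)) ≤ Fintype.card (Fin n) := by
    simpa [sq] using hn
  obtain ⟨ι⟩ := Function.Embedding.nonempty_of_card_le hc
  exact (le_two_mul_ncard_polarityCone ι.injective).trans (Nat.mul_le_mul_left 2
    (ncard_edgeSet_le_exTrace rfl (isUniform_polarityCone ι.injective)
      (not_containsTrace_polarityCone ι.injective)))

theorem le_exTrace_of_isPrimePow {q n : ℕ} (hq : IsPrimePow q) (hn : q ^ 2 + 1 ≤ n) :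
    (q : ℝ) ^ 3 - (q : ℝ) ^ 2 ≤ 2 * (exTrace n 3 cycleFour : ℝ) := by
  obtain ⟨K⟩ := (Fintype.nonempty_field_iff (α := Fin q)).2 (by simpa using hq)
  have h := @le_exTrace_of_field (Fin q) K _ n (by simpa using hn)
  rw [Fintype.card_fin] at h
  have h' : (((q * q - q) * q : ℕ) : ℝ) ≤ ((2 * exTrace n 3 cycleFour : ℕ) : ℝ) := by
    exact_mod_cast h
  rw [Nat.cast_mul, Nat.cast_sub (Nat.le_mul_self q)] at h'
  push_cast at h'
  nlinarith

end TraceTuran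

/-! ### Counting two-edge paths -/

namespace TraceTuran

open Finset

section Relation

variable {V : Type*} [Fintype V] [DecidableEq V]

/-- The double count of two-edge paths: a relation all of whose codegrees are at most `1`, up to an
error `k`, is sparse. -/
theorem sq_card_le_of_codegree_le (G : V → V → Prop) [DecidableRel G] (k : V → V → ℕ)
    (h : ∀ x y, x ≠ y → #{v | G v x ∧ G v y} ≤ 1 + k x y) :
    #{p : V × V | G p.1 p.2} ^ 2 ≤
      Fintype.card V * (Fintype.card V ^ 2 + ∑ x, ∑ y, k x y + #{p : V × V | G p.1 p.2}) := by
  set N : V → Finset V := fun v => univ.filter (G v) with hN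
  have hD : #{p : V × V | G p.1 p.2} = ∑ v, #(N v) := by
    rw [card_eq_sum_card_fiberwise (f := Prod.fst) (t := univ) (fun _ _ => mem_univ _)]
    refine sum_congr rfl fun v _ => ?_
    refine card_bij' (fun p _ => p.2) (fun w _ => (v, w)) ?_ ?_ ?_ ?_
    · rintro ⟨a, b⟩ hp
      simp only [mem_filter, mem_univ, true_and] at hp
      simp [hN, ← hp.2, hp.1]
    · intro w hw
      simpa [hN] using hw
    · rintro ⟨a, b⟩ hp
      simp only [mem_filter, mem_univ, true_and] at hp
      simp [hp.2]
    · simp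
  have hP : ∑ v, #(N v).offDiag ≤ Fintype.card V ^ 2 + ∑ x, ∑ y, k x y := by
    have h1 := sum_card_bipartiteAbove_eq_sum_card_bipartiteBelow
      (s := (univ : Finset V)) (t := (univ : Finset V).offDiag)
      (fun v p => G v p.1 ∧ G v p.2)
    have h2 : ∀ v, #(N v).offDiag =
        #((univ : Finset V).offDiag.bipartiteAbove (fun v p => G v p.1 ∧ G v p.2) v) := by
      intro v
      congr 1
      ext p
      simp only [bipartiteAbove, mem_offDiag, hN, mem_filter, mem_univ, true_and]
      tauto
    simp_rw [h2]
    rw [h1]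
    calc _ ≤ ∑ p ∈ (univ : Finset V).offDiag, (1 + k p.1 p.2) :=
          sum_le_sum fun p hp => h p.1 p.2 (mem_offDiag.1 hp).2.2
      _ ≤ ∑ p : V × V, (1 + k p.1 p.2) :=
          sum_le_sum_of_subset (subset_univ _)
      _ = _ := by
          rw [sum_add_distrib, Fintype.sum_prod_type]
          simp [sq, Fintype.sum_prod_type]
  -- Cauchy–Schwarz turns the bound on two-edge paths into one on the number of related pairs.
  have hCS := sq_sum_le_card_mul_sum_sq (s := (univ : Finset V)) (f := fun v => #(N v))
  have hsq : ∑ v, #(N v) ^ 2 = ∑ v, #(N v).offDiag + ∑ v, #(N v) := by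
    rw [← sum_add_distrib]
    refine sum_congr rfl fun v _ => ?_
    rw [offDiag_card, sq, Nat.sub_add_cancel (Nat.le_mul_self _)]
  rw [hD]
  refine hCS.trans ?_
  rw [hsq, card_univ, Nat.cast_id]
  gcongr

end Relation

/-! ### Upper bound: core and private pairs -/

section TripleSystem

variable {V : Type*} [DecidableEq V]

/-- A family of triples without an induced Berge four-cycle. -/
structure IsTraceFree (H : Finset (Finset V)) : Prop where
  card_eq : ∀ e ∈ H, #e = 3
  no_cycle : ∀ a b c d : V, a ≠ b → a ≠ c → a ≠ d → b ≠ c → b ≠ d → c ≠ d →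
    ∀ w x y z, {a, b, w} ∈ H → w ≠ c → w ≠ d → {b, c, x} ∈ H → x ≠ d → x ≠ a →
    {c, d, y} ∈ H → y ≠ a → y ≠ b → {d, a, z} ∈ H → z ≠ b → z ≠ c → False

variable {H : Finset (Finset V)}

namespace IsTraceFree

theorem ne_of_mem (hH : IsTraceFree H) {a b c : V} (h : {a, b, c} ∈ H) :
    a ≠ b ∧ a ≠ c ∧ b ≠ c := by
  have h3 := hH.card_eq _ h
  refine ⟨?_, ?_, ?_⟩ <;> rintro rfl
  · have := card_le_two (a := a) (b := c)
    simp_all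
  · have := card_le_two (a := b) (b := a)
    rw [insert_comm] at h3
    simp_all
  · have := card_le_two (a := a) (b := b)
    simp_all

theorem exists_eq (hH : IsTraceFree H) {e : Finset V} (he : e ∈ H) {a b : V} (ha : a ∈ e)
    (hb : b ∈ e) (hab : a ≠ b) : ∃ c, e = {a, b, c} := by
  have h3 := hH.card_eq e he
  have h1 : #((e.erase a).erase b) = 1 := by
    rw [card_erase_of_mem (mem_erase.2 ⟨hab.symm, hb⟩), card_erase_of_mem ha, h3]
  obtain ⟨c, hc⟩ := card_eq_one.1 h1
  refine ⟨c, ?_⟩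
  rw [← hc, insert_erase (mem_erase.2 ⟨hab.symm, hb⟩), insert_erase ha]

theorem swap {a b c : V} (h : {a, b, c} ∈ H) : {b, a, c} ∈ H := by rwa [insert_comm]

theorem swap_right {a b c : V} (h : {a, b, c} ∈ H) : {a, c, b} ∈ H := by
  rwa [pair_comm c b]

/-- Links contain no four-cycle. -/
theorem no_cycle_link (hH : IsTraceFree H) {o a b c d : V} (hab : {o, a, b} ∈ H)
    (hbc : {o, b, c} ∈ H) (hcd : {o, c, d} ∈ H) (hda : {o, d, a} ∈ H) (hac : a ≠ c)
    (hbd : b ≠ d) : False := by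
  have h1 := hH.ne_of_mem hab
  have h2 := hH.ne_of_mem hbc
  have h3 := hH.ne_of_mem hcd
  have h4 := hH.ne_of_mem hda
  exact hH.no_cycle a b c d h1.2.2 hac h4.2.2.symm h2.2.2 hbd h3.2.2 o o o o
    (swap_right (swap hab)) h2.2.1 h3.2.1 (swap_right (swap hbc)) h3.2.1 h1.1
    (swap_right (swap hcd)) h1.1 h1.2.1 (swap_right (swap hda)) h1.2.1 h2.2.1

end IsTraceFree

/-- The edges of `H` each of whose pairs lies in a further edge. -/
def core (H : Finset (Finset V)) : Finset (Finset V) :=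
  {e ∈ H | ∀ a ∈ e, ∀ b ∈ e, a ≠ b → ∃ e' ∈ H, e' ≠ e ∧ a ∈ e' ∧ b ∈ e'}

/-- Adjacency in the shadow of the core. -/
def CoreAdj (H : Finset (Finset V)) (a b : V) : Prop := a ≠ b ∧ ∃ e ∈ core H, a ∈ e ∧ b ∈ e

theorem core_subset : core H ⊆ H := filter_subset _ _

namespace IsTraceFree

theorem exists_mem_ne_of_core (hH : IsTraceFree H) {a b c : V} (h : {a, b, c} ∈ core H) :
    ∃ x ≠ c, {a, b, x} ∈ H := by
  obtain ⟨hmem, hc⟩ := mem_filter.1 h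
  have hne := hH.ne_of_mem hmem
  obtain ⟨e', he', hne', ha, hb⟩ := hc a (by simp) b (by simp) hne.1
  obtain ⟨x, rfl⟩ := hH.exists_eq he' ha hb hne.1
  exact ⟨x, fun hx => hne' (by rw [hx]), he'⟩

/-- A pair in the core's shadow lies in at least two edges of `H`, so its third vertex can dodge any
one prescribed vertex. -/
theorem exists_mem_ne_of_coreAdj (hH : IsTraceFree H) {a b : V} (h : CoreAdj H a b) (y : V) :
    ∃ x ≠ y, {a, b, x} ∈ H := by
  obtain ⟨hab, e, he, ha, hb⟩ := h
  obtain ⟨c, rfl⟩ := hH.exists_eq (core_subset he) ha hb hab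
  by_cases hcy : c = y
  · rw [← hcy]; exact hH.exists_mem_ne_of_core he
  · exact ⟨c, hcy, core_subset he⟩

/-- Otherwise `a, c, b, d` is a forbidden cycle: each side has an edge avoiding the third vertex of
its core edge, and the remaining bad choice of third vertex would produce one of the two excluded
edges. -/
theorem mem_or_mem_of_core (hH : IsTraceFree H) {a b c d : V} (hc : {a, b, c} ∈ core H)
    (hd : {a, b, d} ∈ core H) (hcd : c ≠ d) : {a, c, d} ∈ H ∨ {b, c, d} ∈ H := by
  by_contra! hcon
  obtain ⟨h1, h2⟩ := hcon
  have nc := hH.ne_of_mem (core_subset hc)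
  have nd := hH.ne_of_mem (core_subset hd)
  obtain ⟨w, hw, hw'⟩ := hH.exists_mem_ne_of_core (swap_right hc)
  obtain ⟨x, hx, hx'⟩ := hH.exists_mem_ne_of_core (swap_right (swap hc))
  obtain ⟨y, hy, hy'⟩ := hH.exists_mem_ne_of_core (swap_right (swap hd))
  obtain ⟨z, hz, hz'⟩ := hH.exists_mem_ne_of_core (swap_right hd)
  refine hH.no_cycle a c b d nc.2.1 nc.1 nd.2.1 nc.2.2.symm hcd nd.2.2 w x y z hw' hw ?_
    (swap hx') ?_ hx hy' hy ?_ (swap hz') ?_ hz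
  · rintro rfl; exact h1 hw'
  · rintro rfl; exact h2 hx'
  · rintro rfl; exact h2 (swap_right hy')
  · rintro rfl; exact h1 (swap_right hz')

/-- A pair lies in at most two edges of the core. -/
theorem core_pair_le_two (hH : IsTraceFree H) {a b c d e : V} (hc : {a, b, c} ∈ core H)
    (hd : {a, b, d} ∈ core H) (he : {a, b, e} ∈ core H) (hcd : c ≠ d) (hde : d ≠ e)
    (hce : c ≠ e) : False := by
  -- By `mem_or_mem_of_core`, each pair from `c, d, e` is an edge in the link of `a` or of `b`. Two
  -- of these pairs fall in one link and form a path there, which the other vertex of `a, b` closes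
  -- to a four-cycle.
  have path : ∀ {o p c d e : V}, {o, p, c} ∈ H → {o, p, d} ∈ H → {o, p, e} ∈ H → c ≠ e →
      {o, c, d} ∈ H → {o, d, e} ∈ H → False := by
    intro o p c d e hc hd he hce h1 h2
    exact hH.no_cycle_link hc h1 h2 (swap_right he) (hH.ne_of_mem hd).2.2 hce
  have hc' := core_subset hc
  have hd' := core_subset hd
  have he' := core_subset he
  have hbc := swap hc'
  have hbd := swap hd'
  have hbe := swap he'
  rcases hH.mem_or_mem_of_core hc hd hcd with h1 | h1 <;>
  rcases hH.mem_or_mem_of_core hd he hde with h2 | h2 <;>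
  rcases hH.mem_or_mem_of_core hc he hce with h3 | h3
  · exact path hc' hd' he' hce h1 h2
  · exact path hc' hd' he' hce h1 h2
  · exact path hd' hc' he' hde (swap_right h1) h3
  · exact path hbc hbe hbd hcd h3 (swap_right h2)
  · exact path hc' he' hd' hcd h3 (swap_right h2)
  · exact path hbd hbc hbe hde (swap_right h1) h3
  · exact path hbc hbd hbe hce h1 h2
  · exact path hbc hbd hbe hce h1 h2

open Classical in
theorem card_core_le [Fintype V] (hH : IsTraceFree H) :
    #(core H) * 6 ≤ #{p : V × V | CoreAdj H p.1 p.2} * 2 := by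
  refine card_mul_le_card_mul (fun e p => p.1 ∈ e ∧ p.2 ∈ e) ?_ ?_
  · intro e he
    have : e.offDiag ⊆ bipartiteAbove (fun e p => p.1 ∈ e ∧ p.2 ∈ e)
        ({p : V × V | CoreAdj H p.1 p.2} : Finset (V × V)) e := by
      intro p hp
      obtain ⟨h1, h2, h3⟩ := mem_offDiag.1 hp
      simp only [bipartiteAbove, mem_filter, mem_univ, true_and]
      exact ⟨⟨h3, e, he, h1, h2⟩, h1, h2⟩
    calc 6 = #e.offDiag := by rw [offDiag_card, hH.card_eq e (core_subset he)]
      _ ≤ _ := card_le_card this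
  · rintro ⟨a, b⟩ hp
    have hab : a ≠ b := (mem_filter.1 hp).2.1
    by_contra! hcard
    obtain ⟨e₁, e₂, e₃, h1, h2, h3, h12, h13, h23⟩ := two_lt_card_iff.1 hcard
    simp only [bipartiteBelow, mem_filter] at h1 h2 h3
    obtain ⟨c₁, rfl⟩ := hH.exists_eq (core_subset h1.1) h1.2.1 h1.2.2 hab
    obtain ⟨c₂, rfl⟩ := hH.exists_eq (core_subset h2.1) h2.2.1 h2.2.2 hab
    obtain ⟨c₃, rfl⟩ := hH.exists_eq (core_subset h3.1) h3.2.1 h3.2.2 hab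
    exact hH.core_pair_le_two h1.1 h2.1 h3.1 (fun h => h12 (by rw [h]))
      (fun h => h23 (by rw [h])) (fun h => h13 (by rw [h]))

-- Two common neighbours `x, y` outside the link of the pair `u, v` would give a forbidden cycle `u,
-- x, v, y`: on each side the third vertex can dodge one opposite vertex, and the other is excluded
-- because `{u, v, x}` and `{u, v, y}` are not edges.
open Classical in
theorem coreAdj_codegree_le [Fintype V] (hH : IsTraceFree H) {u v : V} (huv : u ≠ v) :
    #{x | CoreAdj H x u ∧ CoreAdj H x v} ≤ 1 + #{x | {u, v, x} ∈ H} := by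
  have hsub : ({x | CoreAdj H x u ∧ CoreAdj H x v} : Finset V) ⊆
      ({x | (CoreAdj H x u ∧ CoreAdj H x v) ∧ {u, v, x} ∉ H} : Finset V) ∪ ({x | {u, v, x} ∈ H} : Finset V) := by
    intro x hx
    simp only [mem_union, mem_filter, mem_univ, true_and] at hx ⊢
    tauto
  refine (card_le_card hsub).trans ((card_union_le _ _).trans (add_le_add_left ?_ _))
  rw [card_le_one]
  intro x hx y hy
  by_contra hxy
  simp only [mem_filter, mem_univ, true_and] at hx hy
  obtain ⟨⟨hxu, hxv⟩, hx⟩ := hx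
  obtain ⟨⟨hyu, hyv⟩, hy⟩ := hy
  obtain ⟨p, hp, hp'⟩ := hH.exists_mem_ne_of_coreAdj hxu y
  obtain ⟨q, hq, hq'⟩ := hH.exists_mem_ne_of_coreAdj hxv y
  obtain ⟨r, hr, hr'⟩ := hH.exists_mem_ne_of_coreAdj hyv x
  obtain ⟨s, hs, hs'⟩ := hH.exists_mem_ne_of_coreAdj hyu x
  refine hH.no_cycle u x v y hxu.1.symm huv hyu.1.symm hxv.1 hxy hyv.1.symm p q r s
    (swap hp') ?_ hp hq' hq ?_ (swap hr') ?_ hr hs' hs ?_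
  · rintro rfl; exact hx (swap_right (swap hp'))
  · rintro rfl; exact hx (swap_right (swap (swap_right hq')))
  · rintro rfl; exact hy (swap_right (swap (swap_right hr')))
  · rintro rfl; exact hy (swap_right (swap hs'))

-- The crude constant suffices: the total is linear in the number of edges, hence negligible beside
-- `n ^ 2`.
open Classical in
theorem sum_codegree_le [Fintype V] (hH : IsTraceFree H) :
    ∑ u : V, ∑ v : V, #{x | {u, v, x} ∈ H} ≤ 27 * #H := by
  have h1 : ∑ u : V, ∑ v : V, #{x | {u, v, x} ∈ H} =
      #{t : V × V × V | {t.1, t.2.1, t.2.2} ∈ H} := by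
    simp only [card_filter, Fintype.sum_prod_type]
  rw [h1]
  refine card_le_mul_card_image_of_maps_to (f := fun t : V × V × V => {t.1, t.2.1, t.2.2})
    (fun t ht => (mem_filter.1 ht).2) 27 fun e he => ?_
  calc _ ≤ #(e ×ˢ (e ×ˢ e)) := by
        refine card_le_card fun t ht => ?_
        obtain ⟨-, rfl⟩ := mem_filter.1 ht
        simp
    _ = 27 := by simp [hH.card_eq e he]

theorem exists_private (e : Finset V) (he : e ∈ H) (hc : e ∉ core H) :
    ∃ p : V × V, p.1 ∈ e ∧ p.2 ∈ e ∧ p.1 ≠ p.2 ∧ ∀ e' ∈ H, p.1 ∈ e' → p.2 ∈ e' → e' = e := by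
  simp only [core, mem_filter, he, true_and] at hc
  push Not at hc
  obtain ⟨a, ha, b, hb, hab, h⟩ := hc
  refine ⟨(a, b), ha, hb, hab, fun e' he' ha' hb' => ?_⟩
  by_contra hne
  exact h e' he' hne ha' hb'

/-- Edges outside the core are at most as many as the edges of a `C₄`-free graph. -/
theorem sq_card_compl_core_le [Fintype V] (hH : IsTraceFree H) :
    (2 * #(H \ core H)) ^ 2 ≤
      Fintype.card V * (Fintype.card V ^ 2 + 2 * #(H \ core H)) := by
  classical
  rcases isEmpty_or_nonempty V with hV | hV
  · have : H \ core H = ∅ := by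
      refine eq_empty_of_forall_notMem fun e he => ?_
      have h3 := hH.card_eq e (mem_sdiff.1 he).1
      rw [Subsingleton.elim e ∅] at h3
      simp at h3
    simp [this]
  have hex : ∀ e ∈ H \ core H, ∃ p : V × V,
      p.1 ∈ e ∧ p.2 ∈ e ∧ p.1 ≠ p.2 ∧ ∀ e' ∈ H, p.1 ∈ e' → p.2 ∈ e' → e' = e := fun e he =>
    exists_private e (mem_sdiff.1 he).1 (mem_sdiff.1 he).2
  choose! p hp using hex
  let G : V → V → Prop := fun a b => ∃ e ∈ H \ core H, p e = (a, b) ∨ p e = (b, a)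
  have hG : ∀ {a b}, G a b → a ≠ b ∧ ∃ w, {a, b, w} ∈ H ∧
      (p {a, b, w} = (a, b) ∨ p {a, b, w} = (b, a)) ∧
      ∀ e' ∈ H, a ∈ e' → b ∈ e' → e' = {a, b, w} := by
    rintro a b ⟨e, he, h⟩
    have hpe := hp e he
    have hfacts : a ∈ e ∧ b ∈ e ∧ a ≠ b ∧ ∀ e' ∈ H, a ∈ e' → b ∈ e' → e' = e := by
      rcases h with h | h <;> rw [h] at hpe
      · exact hpe
      · exact ⟨hpe.2.1, hpe.1, hpe.2.2.1.symm, fun e' he' ha hb => hpe.2.2.2 e' he' hb ha⟩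
    obtain ⟨ha, hb, hab, huniq⟩ := hfacts
    obtain ⟨w, rfl⟩ := hH.exists_eq (mem_sdiff.1 he).1 ha hb hab
    exact ⟨hab, w, (mem_sdiff.1 he).1, h, huniq⟩
  have hsymm : ∀ {a b}, G a b → G b a := fun ⟨e, he, h⟩ => ⟨e, he, h.symm⟩
  -- If the third vertex were `d`, one edge would own both chosen pairs `a, b` and `a, d`, but each
  -- edge chose only one. Hence a four-cycle in `G` lifts to a forbidden trace.
  have hthird : ∀ {a b w d}, {a, b, w} ∈ H → G a b → G a d → d ≠ b → w ≠ d := by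
    rintro a b w d hw hab had hdb rfl
    obtain ⟨hne, w₁, hw₁, hp₁, hu₁⟩ := hG hab
    obtain ⟨hne', w₂, hw₂, hp₂, hu₂⟩ := hG had
    rw [← hu₁ _ hw (by simp) (by simp)] at hp₁
    rw [← hu₂ _ hw (by simp) (by simp)] at hp₂
    rcases hp₁ with h | h <;> rw [h] at hp₂ <;> simp only [Prod.mk.injEq] at hp₂ <;> grind
  have hcodeg : ∀ x y, x ≠ y → #{v | G v x ∧ G v y} ≤ 1 + 0 := by
    intro x y hxy
    rw [card_le_one]
    intro u hu v hv
    by_contra huv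
    simp only [mem_filter, mem_univ, true_and] at hu hv
    obtain ⟨hux, huy⟩ := hu
    obtain ⟨hvx, hvy⟩ := hv
    obtain ⟨n1, a, ha, -⟩ := hG hux
    obtain ⟨n2, b, hb, -⟩ := hG huy
    obtain ⟨n3, c, hc, -⟩ := hG hvy
    obtain ⟨n4, d, hd, -⟩ := hG hvx
    exact hH.no_cycle x u y v n1.symm hxy n4.symm n2 huv n3.symm a b c d
      (swap ha) (hthird ha hux huy hxy.symm)
      (hthird (swap ha) (hsymm hux) (hsymm hvx) (Ne.symm huv))
      hb (hthird (swap hb) (hsymm huy) (hsymm hvy) (Ne.symm huv)) (hthird hb huy hux hxy)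
      (swap hc) (hthird hc hvy hvx hxy) (hthird (swap hc) (hsymm hvy) (hsymm huy) huv)
      hd (hthird (swap hd) (hsymm hvx) (hsymm hux) huv) (hthird hd hvx hvy hxy.symm)
  have hinj : Set.InjOn p (H \ core H : Finset (Finset V)) := by
    intro e he e' he' h
    have h1 := hp e he
    have h2 := hp e' he'
    rw [← h] at h2
    exact h2.2.2.2 e (mem_sdiff.1 he).1 h1.1 h1.2.1
  have hcard : 2 * #(H \ core H) ≤ #{q : V × V | G q.1 q.2} := by
    have hdisj : Disjoint ((H \ core H).image p) ((H \ core H).image fun e => (p e).swap) := by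
      rw [disjoint_left]
      rintro q hq hq'
      obtain ⟨e, he, rfl⟩ := mem_image.1 hq
      obtain ⟨e', he', h⟩ := mem_image.1 hq'
      have h1 := hp e he
      have h2 := hp e' he'
      rw [← h] at h1
      have : e' = e := h1.2.2.2 e' (mem_sdiff.1 he').1 h2.2.1 h2.1
      subst this
      exact h2.2.2.1 (congrArg Prod.snd h)
    calc 2 * #(H \ core H)
        = #((H \ core H).image p) + #((H \ core H).image fun e => (p e).swap) := by
          rw [card_image_of_injOn hinj, card_image_of_injOn (f := fun e => (p e).swap)
            (Prod.swap_injective.comp_injOn hinj), two_mul]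
      _ = #((H \ core H).image p ∪ (H \ core H).image fun e => (p e).swap) :=
          (card_union_of_disjoint hdisj).symm
      _ ≤ _ := by
          refine card_le_card fun q hq => ?_
          simp only [mem_filter, mem_univ, true_and]
          rcases mem_union.1 hq with hq | hq <;> obtain ⟨e, he, rfl⟩ := mem_image.1 hq
          · exact ⟨e, he, .inl rfl⟩
          · exact ⟨e, he, .inr rfl⟩
  have hmain := sq_card_le_of_codegree_le G (fun _ _ => 0) hcodeg
  simp only [sum_const_zero, add_zero] at hmain
  set D := #{q : V × V | G q.1 q.2}
  set t := 2 * #(H \ core H)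
  -- The quadratic bound passes from `D` to the smaller `t`, as `x ^ 2 - n * x` increases for `x ≥
  -- n`, where `n` is the number of vertices.
  by_contra! hlt
  have h1 : Fintype.card V < t := by
    by_contra! h
    nlinarith
  obtain ⟨i, hi⟩ := Nat.exists_eq_add_of_lt h1
  obtain ⟨j, hj⟩ := Nat.exists_eq_add_of_le hcard
  rw [hj] at hmain
  rw [hi] at hlt hmain
  nlinarith [Nat.zero_le (i * j), Nat.zero_le (j * j), Nat.zero_le (Fintype.card V * j)]

theorem bound_of_quadratic_bounds {m h₁ h₂ D : ℕ}
    (e1 : (2 * h₁ : ℝ) ^ 2 ≤ m * ((m : ℝ) ^ 2 + 2 * h₁)) (e2 : (h₂ : ℝ) * 6 ≤ D * 2)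
    (e3 : (D : ℝ) ^ 2 ≤ m * ((m : ℝ) ^ 2 + 27 * (h₁ + h₂) + D)) :
    ((h₁ + h₂ : ℕ) : ℝ) ≤ 5 / 6 * (m : ℝ) ^ (3 / 2 : ℝ) + 7 * m := by
  push_cast
  have hD0 : (0 : ℝ) ≤ D := D.cast_nonneg
  have hn : (0 : ℝ) ≤ m := m.cast_nonneg
  set n : ℝ := (m : ℝ) with hnm
  set s : ℝ := n ^ (3 / 2 : ℝ) with hs
  have hs0 : 0 ≤ s := by positivity
  have hs2 : s ^ 2 = n ^ 3 := by
    rw [hs, ← Real.rpow_natCast, ← Real.rpow_natCast, ← Real.rpow_mul hn]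
    norm_num
  have hsn : n ≤ s := by
    rcases Nat.eq_zero_or_pos m with hm | hm
    · simpa [hnm, hm] using hs0
    · have : (1 : ℝ) ≤ n := Nat.one_le_cast.2 hm
      refine le_of_sq_le_sq ?_ hs0
      rw [hs2]
      nlinarith [sq_nonneg n]
  have f1 : 2 * (h₁ : ℝ) ≤ s + n := by
    by_contra! h
    nlinarith [mul_nonneg hs0 hn]
  -- Inserting the bounds on `h₁` and `h₂` gives `D * (D - 10 * n) ≤ s ^ 2 + 27 * n * s`. This fails
  -- beyond `s + 19 * n`, because `(s + 19 * n) * (s + 9 * n)` has middle term `28 * n * s`.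
  have f2 : (D : ℝ) ≤ s + 19 * n := by
    by_contra! h
    have h3 : n * (27 * (h₁ + h₂) + D) ≤ n * (27 * s + 10 * D) :=
      mul_le_mul_of_nonneg_left (by linarith) hn
    have h4 : (D : ℝ) * (D - 10 * n) ≤ s ^ 2 + 27 * (n * s) := by nlinarith
    have h5 : 0 ≤ (D - (s + 19 * n)) * ((D : ℝ) - 10 * n) :=
      mul_nonneg (by linarith) (by linarith)
    have h6 : 0 < (s + 19 * n) * ((D : ℝ) - 10 * n - (s + 9 * n)) ∨ s + 19 * n = 0 := by
      rcases (by positivity : 0 ≤ s + 19 * n).eq_or_lt with h0 | h0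
      · exact .inr h0.symm
      · exact .inl (mul_pos h0 (by linarith))
    rcases h6 with h6 | h6
    · nlinarith [mul_nonneg hn hs0, mul_nonneg hn hn]
    · have hs' : s = 0 := by linarith
      have hn' : n = 0 := by linarith
      rw [hs', hn'] at h4 h
      nlinarith
  linarith

/-- The number of edges of a triple system without an induced Berge four-cycle. -/
theorem card_le [Fintype V] (hH : IsTraceFree H) :
    (#H : ℝ) ≤ 5 / 6 * (Fintype.card V : ℝ) ^ (3 / 2 : ℝ) + 7 * Fintype.card V := by
  classical
  have e1 := hH.sq_card_compl_core_le
  have e2 := hH.card_core_le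
  have e0 := sq_card_le_of_codegree_le (CoreAdj H) (fun u v => #{x | {u, v, x} ∈ H})
    fun u v huv => by convert! hH.coreAdj_codegree_le huv
  have e3 : #{p : V × V | CoreAdj H p.1 p.2} ^ 2 ≤
      Fintype.card V * (Fintype.card V ^ 2 + 27 * #H + #{p : V × V | CoreAdj H p.1 p.2}) := by
    refine e0.trans ?_
    gcongr
    exact hH.sum_codegree_le
  have e4 : #H = #(H \ core H) + #(core H) := (card_sdiff_add_card_eq_card core_subset).symm
  set D := #{p : V × V | CoreAdj H p.1 p.2}
  rw [e4] at e3 ⊢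
  generalize #(H \ core H) = h₁ at *
  generalize #(core H) = h₂ at *
  generalize Fintype.card V = m at *
  clear_value D
  refine bound_of_quadratic_bounds (D := D) ?_ ?_ ?_
  · exact_mod_cast e1
  · exact_mod_cast e2
  · exact_mod_cast e3

end IsTraceFree

end TripleSystem

/-- Upper bound for the trace Turán number of the four-cycle. -/
theorem exTrace_three_cycleFour_le (n : ℕ) :
    (exTrace n 3 cycleFour : ℝ) ≤ 5 / 6 * (n : ℝ) ^ (3 / 2 : ℝ) + 7 * n := by
  classical
  -- The edgeless hypergraph makes the set nonempty, so the supremum is attained.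
  have hne : {m : ℕ | ∃ H : Hypergraph (Fin n), V(H) = Set.univ ∧ IsUniform H 3 ∧
      ¬ ContainsTrace H cycleFour ∧ E(H).ncard = m}.Nonempty := by
    refine ⟨_, Hypergraph.trivialOn Set.univ, rfl, fun e h => absurd h (Set.notMem_empty e),
      ?_, rfl⟩
    rw [containsTrace_cycleFour_iff]
    rintro ⟨f, -, -, e, he⟩
    exact (he 0).1
  obtain ⟨H, hV, h3, hfree, hcard⟩ := Nat.sSup_mem hne (bddAbove_exTrace n 3 cycleFour)
  set E : Finset (Finset (Fin n)) := {e | (e : Set (Fin n)) ∈ E(H)} with hE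
  have hEcard : #E = exTrace n 3 cycleFour := by
    rw [exTrace, ← hcard, ← Set.ncard_coe_finset,
      ← Set.ncard_image_of_injective _ Finset.coe_injective]
    congr 1
    ext s
    simp only [hE, coe_filter, mem_univ, true_and, Set.mem_image, Set.mem_ofPred_eq]
    constructor
    · rintro ⟨e, he, rfl⟩; exact he
    · intro hs
      exact ⟨s.toFinset, by simpa using hs, by simp⟩
  have hE' : IsTraceFree E := by
    refine ⟨fun e he => ?_, ?_⟩
    · have := h3 _ (mem_filter.1 he).2
      rw [Set.encard_coe_eq_coe_finsetCard] at this
      exact_mod_cast this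
    · intro a b c d hab hac had hbc hbd hcd w x y z hw hwc hwd hx hxd hxa hy hya hyb hz hzb hzc
      refine hfree (containsTrace_cycleFour_iff.2 ⟨![a, b, c, d], ?_, fun i => by simp [hV],
        ![↑({a, b, w} : Finset (Fin n)), ↑({b, c, x} : Finset (Fin n)),
          ↑({c, d, y} : Finset (Fin n)), ↑({d, a, z} : Finset (Fin n))], ?_⟩)
      · intro i j hij
        fin_cases i <;> fin_cases j <;> simp_all
      · intro i
        have hmem : ∀ {e}, e ∈ E → (e : Set (Fin n)) ∈ E(H) := fun he => (mem_filter.1 he).2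
        fin_cases i
        · refine ⟨hmem hw, ?_⟩
          ext v; simp; grind
        · refine ⟨hmem hx, ?_⟩
          ext v; simp; grind
        · refine ⟨hmem hy, ?_⟩
          ext v; simp; grind
        · refine ⟨hmem hz, ?_⟩
          ext v; simp; grind
  have := hE'.card_le
  rwa [hEcard, Fintype.card_fin] at this

end TraceTuran

/-! ### Asymptotics -/

namespace TraceTuran

theorem eventually_le_exTrace_three_cycleFour {c : ℝ} (hc : 0 < c) :
    ∀ᶠ n : ℕ in atTop, (1 / 2 - c) * (n : ℝ) ^ (3 / 2 : ℝ) ≤ (exTrace n 3 cycleFour : ℝ) := by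
  set ε : ℝ := min (c / 4) (1 / 2) with hεdef
  have hε : 0 < ε := by positivity
  have hε1 : ε ≤ 1 / 2 := min_le_right _ _
  have hεc : ε ≤ c / 4 := min_le_left _ _
  obtain ⟨X, hX⟩ := exists_isPrimePow_between hε (by linarith)
  have hsqrt : Tendsto (fun n : ℕ => √(n : ℝ)) atTop atTop :=
    Real.tendsto_sqrt_atTop.comp tendsto_natCast_atTop_atTop
  filter_upwards [hsqrt.eventually_ge_atTop (2 * |X|), hsqrt.eventually_ge_atTop (1 / ε)]
    with n h1 h2
  set r : ℝ := √(n : ℝ) with hr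
  have hr1 : 1 ≤ ε * r := by
    rw [div_le_iff₀ hε] at h2; linarith
  have hr0 : 0 < r := by
    by_contra! h
    nlinarith
  have hrn : r ^ 2 = n := Real.sq_sqrt n.cast_nonneg
  have hr3 : (n : ℝ) ^ (3 / 2 : ℝ) = r ^ 3 := by
    rw [hr, Real.sqrt_eq_rpow, ← Real.rpow_natCast, ← Real.rpow_mul n.cast_nonneg]
    norm_num
  -- Aiming at `(1 - ε) * r` instead of `r` leaves room for the apex, `q ^ 2 + 1 ≤ n`. The total
  -- relative loss in `q ^ 3 - q ^ 2` is then at most `7 * ε`, and half of it is below `c`.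
  obtain ⟨q, hq, hq1, hq2⟩ := hX ((1 - ε) * r) (by nlinarith [le_abs_self X, abs_nonneg X])
  have hqr : (q : ℝ) ≤ r := by nlinarith
  have hqn : q ^ 2 + 1 ≤ n := by
    have : (q : ℝ) ^ 2 + 1 ≤ n := by
      have h3 : (q : ℝ) ^ 2 ≤ ((1 - ε) * r) ^ 2 := by gcongr
      rw [← hrn]
      nlinarith [mul_pos hε hr0]
    exact_mod_cast this
  have h := le_exTrace_of_isPrimePow hq hqn
  have h4 : (1 - 6 * ε) * r ^ 3 ≤ (q : ℝ) ^ 3 := by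
    have hb : 1 - 6 * ε ≤ (1 - ε) ^ 6 := by
      have := one_add_mul_le_pow (a := -ε) (by linarith) 6
      have e : (1 + -ε) = 1 - ε := by ring
      rw [e] at this
      push_cast at this
      linarith
    calc (1 - 6 * ε) * r ^ 3 ≤ (1 - ε) ^ 6 * r ^ 3 := by gcongr
      _ = ((1 - ε) * ((1 - ε) * r)) ^ 3 := by ring
      _ ≤ (q : ℝ) ^ 3 := by
        have : 0 ≤ (1 - ε) * ((1 - ε) * r) := by
          have : 0 ≤ 1 - ε := by linarith
          positivity
        gcongr
  have h5 : (q : ℝ) ^ 2 ≤ ε * r ^ 3 := by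
    calc (q : ℝ) ^ 2 ≤ r ^ 2 := by gcongr
      _ = 1 * r ^ 2 := (one_mul _).symm
      _ ≤ (ε * r) * r ^ 2 := by gcongr
      _ = _ := by ring
  rw [hr3]
  have h6 : 0 ≤ (c - 4 * ε) * r ^ 3 := by
    have : 0 ≤ c - 4 * ε := by linarith
    positivity
  nlinarith [pow_pos hr0 3]

end TraceTuran

theorem theorem6 :
    ∃ f g : ℕ → ℝ,
      f =o[atTop] (fun n : ℕ => (n : ℝ) ^ (3 / 2 : ℝ)) ∧
      g =o[atTop] (fun n : ℕ => (n : ℝ) ^ (3 / 2 : ℝ)) ∧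
      ∀ n : ℕ,
        (1 / 2 : ℝ) * (n : ℝ) ^ (3 / 2 : ℝ) + f n ≤
            (TraceTuran.exTrace n 3 TraceTuran.cycleFour : ℝ) ∧
        (TraceTuran.exTrace n 3 TraceTuran.cycleFour : ℝ) ≤
            (5 / 6 : ℝ) * (n : ℝ) ^ (3 / 2 : ℝ) + g n := by
  -- The lower error term is the actual deficit, cut off at `0` so that only the eventual lower
  -- bound is needed.
  refine ⟨fun n => min 0 (TraceTuran.exTrace n 3 TraceTuran.cycleFour -
    (1 / 2 : ℝ) * (n : ℝ) ^ (3 / 2 : ℝ)), fun n => 7 * n, ?_, ?_, fun n => ⟨?_, ?_⟩⟩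
  · refine IsLittleO.of_bound fun c hc => ?_
    filter_upwards [TraceTuran.eventually_le_exTrace_three_cycleFour hc] with n hn
    have h0 : 0 ≤ (n : ℝ) ^ (3 / 2 : ℝ) := by positivity
    rw [Real.norm_of_nonneg h0, Real.norm_of_nonpos (min_le_left _ _), neg_le]
    refine le_min ?_ ?_
    · have := mul_nonneg hc.le h0
      linarith
    · linarith
  · refine IsLittleO.const_mul_left ?_ 7
    have h : (fun x : ℝ => x) =o[atTop] fun x : ℝ => x ^ (3 / 2 : ℝ) := by
      refine isLittleO_of_tendsto' ?_ ?_
      · filter_upwards [eventually_gt_atTop 0] with x hx h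
        exact absurd h (Real.rpow_pos_of_pos hx _).ne'
      · refine (tendsto_rpow_neg_atTop (y := 1 / 2) (by norm_num)).congr' ?_
        filter_upwards [eventually_gt_atTop 0] with x hx
        rw [← Real.rpow_one_sub' hx.le (by norm_num)]
        norm_num
    exact h.comp_tendsto tendsto_natCast_atTop_atTop
  · have := min_le_right 0 ((TraceTuran.exTrace n 3 TraceTuran.cycleFour : ℝ) -
      (1 / 2 : ℝ) * (n : ℝ) ^ (3 / 2 : ℝ))
    linarith
  · exact TraceTuran.exTrace_three_cycleFour_le n
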